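/- Let $m \ge 3$ be an integer. There exist a complex vector space $V$ of countably infinite dimension and symmetric multilinear forms $\omega_1 \colon V^{m^2+m} \to \mathbf{C}$, $\omega_2 \colon V^m \to \mathbf{C}$ and $\omega_3 \colon V^m \to \mathbf{C}$ (that is, a symmetric $(m^2+m,m,m)$-space $V$) with the following property. Let $\mathrm{Aut}(V)$ be the group of all invertible linear maps $g \colon V \to V$ such that $\omega_i(gv_1, gv_2, \ldots) = \omega_i(v_1, v_2, \ldots)$ for each $i$ and all vectors $v_j \in V$. Then for every integer $k \ge 0$, the tensor power $V^{\otimes k}$ (over $\mathbf{C}$, with $g(v_1 \otimes \cdots \otimes v_k) = gv_1 \otimes \cdots \otimes gv_k$) is a finite length representation of $\mathrm{Aut}(V)$ if and only if $k < m$. -/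

import Mathlib

open scoped TensorProduct MonoidAlgebra Cardinal

/-- The forms of a `d`-space: for a tuple `d = (d₁, …, d_r)` of (positive) integers, a family of
multilinear forms `ω i : V^{d i} → ℂ` on the complex vector space `V`. -/
structure TensorForms {r : ℕ} (d : Fin r → ℕ) (V : Type*) [AddCommGroup V] [Module ℂ V] where
  /-- The `i`-th form. -/
  form : ∀ i : Fin r, MultilinearMap ℂ (fun _ : Fin (d i) => V) ℂ

namespace TensorForms

/-- The `d`-space is symmetric if every one of its forms is symmetric. -/
def IsSymmetric {r : ℕ} {d : Fin r → ℕ} {V : Type*} [AddCommGroup V] [Module ℂ V]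
    (T : TensorForms d V) : Prop :=
  ∀ (i : Fin r) (σ : Equiv.Perm (Fin (d i))) (v : Fin (d i) → V),
    T.form i (fun j => v (σ j)) = T.form i v

/-- The automorphism group of a `d`-space: the group of all invertible linear maps of `V`
preserving each of the forms. -/
def aut {r : ℕ} {d : Fin r → ℕ} {V : Type*} [AddCommGroup V] [Module ℂ V]
    (T : TensorForms d V) : Subgroup (V ≃ₗ[ℂ] V) where
  carrier := {g | ∀ (i : Fin r) (v : Fin (d i) → V), T.form i (fun j => g (v j)) = T.form i v}
  mul_mem' {g h} hg hh := fun i v => (hg i (fun j => h (v j))).trans (hh i v)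
  one_mem' := fun _ _ => rfl
  inv_mem' {g} hg := fun i v => by
    have h := hg i (fun j => g⁻¹ (v j))
    have e : (fun j => g (g⁻¹ (v j))) = v := funext fun j => g.apply_symm_apply (v j)
    rw [e] at h
    exact h.symm

/-- The representation of the automorphism group on the tensor power `V^{⊗ k}` (over `ℂ`), given by
`g • (v₁ ⊗ ⋯ ⊗ v_k) = g v₁ ⊗ ⋯ ⊗ g v_k`. -/
noncomputable def tensorPowerRep {r : ℕ} {d : Fin r → ℕ} {V : Type*} [AddCommGroup V] [Module ℂ V]
    (T : TensorForms d V) (k : ℕ) : Representation ℂ T.aut (⨂[ℂ]^k V) where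
  toFun g := PiTensorProduct.map fun _ : Fin k => ((g : V ≃ₗ[ℂ] V) : V →ₗ[ℂ] V)
  map_one' := PiTensorProduct.map_one
  map_mul' g h := PiTensorProduct.map_comp
    (fun _ : Fin k => ((g : V ≃ₗ[ℂ] V) : V →ₗ[ℂ] V)) (fun _ => ((h : V ≃ₗ[ℂ] V) : V →ₗ[ℂ] V))

end TensorForms

/-!
The space is `V = ℕ →₀ ℂ`. Fix a coloring `κ` of the `m`-element subsets of `ℕ` by natural numbers
which is generic, that is, an edge-colored random `m`-uniform hypergraph; every other finite set
gets the color `1`. In each degree take the symmetric multilinear form whose value at a tuple of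
basis vectors is the color of the set of these vectors if each of them occurs a multiple of `m`
times, and `0` otherwise (`balancedForm`). In degree `m` this is the Fermat form `∑ x_i ^ m`, whose
linear symmetries are monomial matrices with `m`-th roots of unity as entries since `m ≥ 3`
(`exists_monomial_of_balancedForm_comp`). In degree `m ^ 2 + m` every `m`-element set of variables
carries a monomial `x_{i_1} ^ (2 * m) * x_{i_2} ^ m * ⋯ * x_{i_m} ^ m`, so invariance of the form
says that the underlying permutation preserves `κ` (`color_image_eq_of_balancedForm_comp`).
Conversely all such monomial matrices are automorphisms (`exists_aut_monomial`). The two forms of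
degree `m` coincide. The group is thus the wreath product of the `m`-th roots of unity with the
automorphism group of `κ`.

For `k < m` the diagonal matrices separate the tensor monomials according to the multiplicities of
the basis vectors in them, and, `κ` being homogeneous and trivial on fewer than `m` points, every
weight can be moved into the span of the monomials in the first `m` basis vectors. A
subrepresentation of `V^{⊗ k}` is therefore determined by its intersection with this
finite-dimensional space (`le_of_inf_initialTensors_le`), whence finite length.

For `k ≥ m` the tensor monomials involving exactly `m` basis vectors, of color at most `n`, span a
subrepresentation which grows strictly with `n` (`colorFiltration_strictMono`), so `V^{⊗ k}` is not
Noetherian.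
-/

/-! ### A generic coloring of the `m`-subsets of `ℕ` -/

/-- A coloring of the finite subsets of `ℕ` which is trivial outside the `m`-element subsets and
has the extension property of the random `m`-uniform hypergraph with edges colored by `ℕ`: over
every finite set `A`, some new point realizes any prescribed colors of the `m`-subsets that it
forms with points of `A`. -/
structure IsGenericColoring (m : ℕ) (κ : Finset ℕ → ℕ) : Prop where
  eq_one : ∀ S : Finset ℕ, S.card ≠ m → κ S = 1
  exists_insert : ∀ (A : Finset ℕ) (φ : Finset ℕ → ℕ),
    ∃ x ∉ A, ∀ B ⊆ A, B.card + 1 = m → κ (insert x B) = φ B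

theorem exists_isGenericColoring (m : ℕ) : ∃ κ, IsGenericColoring m κ := by
  classical
  obtain ⟨f, hf⟩ := exists_surjective_nat (ℕ × (Finset ℕ →₀ ℕ))
  -- The greatest element `x` of a set encodes, through `(f x).2`, the colors of the sets it tops.
  refine ⟨fun S => if S.card = m then (f (S.sup id)).2 (S.erase (S.sup id)) else 1,
    fun S hS => if_neg hS, fun A φ => ?_⟩
  let ψ : Finset ℕ →₀ ℕ := Finsupp.onFinset A.powerset (fun B => if B ⊆ A then φ B else 0)
    (by intro B hB; by_contra h; exact hB (if_neg (by simpa using h)))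
  -- Every code is used infinitely often, hence beyond all elements of `A`.
  have hinf : (Set.range fun j : ℕ => Function.surjInv hf (j, ψ)).Infinite :=
    Set.infinite_range_of_injective fun i j hij => by
      simpa using Function.injective_surjInv hf hij
  obtain ⟨_, ⟨j, rfl⟩, hx⟩ := hinf.exists_gt (A.sup id)
  set x := Function.surjInv hf (j, ψ) with hxdef
  have hlt : ∀ y ∈ A, y < x := fun y hy => (Finset.le_sup (f := id) hy).trans_lt hx
  have hxA : x ∉ A := fun h => (hlt x h).false
  have hfx : f x = (j, ψ) := Function.surjInv_eq hf _
  refine ⟨x, hxA, fun B hB hcard => ?_⟩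
  have hxB : x ∉ B := fun h => hxA (hB h)
  have hsup : (insert x B).sup id = x := by
    rw [Finset.sup_insert]
    exact sup_eq_left.2 (Finset.sup_le fun y hy => (hlt y (hB hy)).le)
  rw [if_pos (by rw [Finset.card_insert_of_notMem hxB, hcard]), hsup,
    Finset.erase_insert hxB, hfx]
  simp [ψ, hB]

/-- A finite partial automorphism of a coloring, encoded as its graph. -/
def PartialAut (κ : Finset ℕ → ℕ) : Type :=
  { p : Finset (ℕ × ℕ) // (∀ q ∈ p, ∀ q' ∈ p, q.1 = q'.1 ↔ q.2 = q'.2) ∧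
    ∀ T ⊆ p, κ (T.image Prod.fst) = κ (T.image Prod.snd) }
deriving Preorder

namespace PartialAut

variable {κ : Finset ℕ → ℕ}

theorem fst_injOn (p : PartialAut κ) : Set.InjOn Prod.fst (p.val : Set (ℕ × ℕ)) :=
  fun q hq q' hq' h => Prod.ext h ((p.2.1 q hq q' hq').1 h)

theorem snd_injOn (p : PartialAut κ) : Set.InjOn Prod.snd (p.val : Set (ℕ × ℕ)) :=
  fun q hq q' hq' h => Prod.ext ((p.2.1 q hq q' hq').2 h) h

/-- The inverse of a partial automorphism. -/
def inv (p : PartialAut κ) : PartialAut κ :=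
  ⟨p.val.image Prod.swap, by
    simp only [Finset.forall_mem_image]
    exact fun q hq q' hq' => (p.2.1 q hq q' hq').symm, by
    intro T hT
    have h := p.2.2 (T.image Prod.swap) (fun q hq => by
      obtain ⟨r, hr, rfl⟩ := Finset.mem_image.1 hq
      obtain ⟨s, hs, rfl⟩ := Finset.mem_image.1 (hT hr)
      simpa using hs)
    rw [Finset.image_image, Finset.image_image] at h
    exact h.symm⟩

theorem mem_inv {p : PartialAut κ} {a b : ℕ} : (a, b) ∈ p.inv.val ↔ (b, a) ∈ p.val := by
  simp [inv]

theorem exists_extension {m : ℕ} (hκ : IsGenericColoring m κ) (p : PartialAut κ) (a : ℕ) :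
    ∃ p' : PartialAut κ, (∃ b, (a, b) ∈ p'.val) ∧ p ≤ p' := by
  classical
  by_cases ha : ∃ b, (a, b) ∈ p.val
  · exact ⟨p, ha, le_rfl⟩
  obtain ⟨x, hx, hφ⟩ := hκ.exists_insert (p.val.image Prod.snd)
    fun B => κ (insert a ((p.val.filter (·.2 ∈ B)).image Prod.fst))
  have ha' : ∀ q ∈ p.val, q.1 ≠ a := fun q hq h => ha ⟨q.2, h ▸ hq⟩
  have hx' : ∀ q ∈ p.val, q.2 ≠ x := fun q hq h => hx (Finset.mem_image.2 ⟨q, hq, h⟩)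
  refine ⟨⟨insert (a, x) p.val, ?_, ?_⟩, ⟨x, Finset.mem_insert_self _ _⟩,
    Finset.subset_insert _ _⟩
  · intro q hq q' hq'
    rcases Finset.mem_insert.1 hq with rfl | hq <;> rcases Finset.mem_insert.1 hq' with rfl | hq'
    · simp
    · simp [(ha' q' hq').symm, (hx' q' hq').symm]
    · simp [ha' q hq, hx' q hq]
    · exact p.2.1 q hq q' hq'
  · intro T hT
    by_cases hmem : (a, x) ∈ T
    · obtain ⟨U, hU, rfl⟩ : ∃ U, (a, x) ∉ U ∧ insert (a, x) U = T :=
        ⟨T.erase (a, x), Finset.notMem_erase _ _, Finset.insert_erase hmem⟩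
      have hUp : U ⊆ p.val := (Finset.insert_subset_insert_iff hU).1 hT
      have h1 : (U.image Prod.fst).card = U.card :=
        Finset.card_image_of_injOn (p.fst_injOn.mono hUp)
      have h2 : (U.image Prod.snd).card = U.card :=
        Finset.card_image_of_injOn (p.snd_injOn.mono hUp)
      have ha1 : a ∉ U.image Prod.fst := fun h => by
        obtain ⟨q, hq, h⟩ := Finset.mem_image.1 h
        exact ha' q (hUp hq) h
      have hx1 : x ∉ U.image Prod.snd := fun h => by
        obtain ⟨q, hq, h⟩ := Finset.mem_image.1 h
        exact hx' q (hUp hq) h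
      rw [Finset.image_insert, Finset.image_insert]
      by_cases hc : U.card + 1 = m
      · rw [hφ _ (Finset.image_subset_image hUp) (by rw [h2, hc])]
        congr 3
        ext q
        simp only [Finset.mem_filter, Finset.mem_image]
        constructor
        · exact fun hq => ⟨hUp hq, q, hq, rfl⟩
        · rintro ⟨hq, r, hr, hrq⟩
          exact p.snd_injOn (hUp hr) hq hrq ▸ hr
      · rw [hκ.eq_one, hκ.eq_one]
        · rwa [Finset.card_insert_of_notMem hx1, h2]
        · rwa [Finset.card_insert_of_notMem ha1, h1]
    · exact p.2.2 T fun q hq =>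
        (Finset.mem_insert.1 (hT hq)).resolve_left fun h => hmem (h ▸ hq)

theorem exists_extension_inv {m : ℕ} (hκ : IsGenericColoring m κ) (p : PartialAut κ) (b : ℕ) :
    ∃ p' : PartialAut κ, (∃ a, (a, b) ∈ p'.val) ∧ p ≤ p' := by
  obtain ⟨p', ⟨a, ha⟩, hle⟩ := exists_extension hκ p.inv b
  refine ⟨p'.inv, ⟨a, mem_inv.2 ha⟩, ?_⟩
  rintro ⟨x, y⟩ hq
  exact mem_inv.2 (hle (mem_inv.2 hq))

/-- Back and forth: every finite partial automorphism extends to an automorphism. -/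
theorem exists_perm {m : ℕ} (hκ : IsGenericColoring m κ) (p : PartialAut κ) :
    ∃ π : Equiv.Perm ℕ, (∀ S, κ (S.image π) = κ S) ∧ ∀ q ∈ p.val, π q.1 = q.2 := by
  classical
  let D : ℕ ⊕ ℕ → Order.Cofinal (PartialAut κ) := Sum.elim
    (fun a => ⟨{f | ∃ b, (a, b) ∈ f.val}, fun p => exists_extension hκ p a⟩)
    (fun b => ⟨{f | ∃ a, (a, b) ∈ f.val}, fun p => exists_extension_inv hκ p b⟩)
  let I := Order.idealOfCofinals p D
  have hF : ∀ a, ∃ b, ∃ f ∈ I, (a, b) ∈ f.val := fun a =>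
    let ⟨f, ⟨b, hb⟩, hf⟩ := Order.cofinal_meets_idealOfCofinals p D (Sum.inl a)
    ⟨b, f, hf, hb⟩
  have hG : ∀ b, ∃ a, ∃ f ∈ I, (a, b) ∈ f.val := fun b =>
    let ⟨f, ⟨a, ha⟩, hf⟩ := Order.cofinal_meets_idealOfCofinals p D (Sum.inr b)
    ⟨a, f, hf, ha⟩
  have huniq : ∀ a b a' b', (∃ f ∈ I, (a, b) ∈ f.val) → (∃ f ∈ I, (a', b') ∈ f.val) →
      (a = a' ↔ b = b') := by
    rintro a b a' b' ⟨f, hf, hab⟩ ⟨f', hf', hab'⟩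
    obtain ⟨h, -, h1, h2⟩ := I.directed f hf f' hf'
    exact h.2.1 _ (h1 hab) _ (h2 hab')
  choose F hF using hF
  choose G hG using hG
  refine ⟨⟨F, G, fun a => (huniq _ _ _ _ (hG (F a)) (hF a)).2 rfl,
    fun b => (huniq _ _ _ _ (hF (G b)) (hG b)).1 rfl⟩, fun S => ?_, fun q hq => ?_⟩
  · change κ (S.image F) = κ S
    obtain ⟨f, -, hf⟩ : ∃ f ∈ I, ∀ a ∈ S, (a, F a) ∈ f.val := by
      induction S using Finset.induction with
      | empty => exact ⟨p, Order.mem_idealOfCofinals p D, by simp⟩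
      | insert a S _ ih =>
        obtain ⟨f, hf, hfS⟩ := ih
        obtain ⟨f', hf', ha⟩ := hF a
        obtain ⟨h, hh, h1, h2⟩ := I.directed f hf f' hf'
        refine ⟨h, hh, fun b hb => ?_⟩
        rcases Finset.mem_insert.1 hb with rfl | hb
        · exact h2 ha
        · exact h1 (hfS b hb)
    have := f.2.2 (S.image fun a => (a, F a)) (Finset.image_subset_iff.2 hf)
    rw [Finset.image_image, Finset.image_image] at this
    exact (this.symm.trans (by congr 1; exact Finset.image_id))
  · exact (huniq _ _ _ _ (hF q.1) ⟨p, Order.mem_idealOfCofinals p D, hq⟩).1 rfl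

end PartialAut

namespace IsGenericColoring

variable {m : ℕ} {κ : Finset ℕ → ℕ}

/-- Sets of fewer than `m` points carry no structure, so automorphisms move them freely. -/
theorem exists_perm_image_lt (hκ : IsGenericColoring m κ) {S : Finset ℕ} (hS : S.card < m) :
    ∃ π : Equiv.Perm ℕ, (∀ U, κ (U.image π) = κ U) ∧ ∀ s ∈ S, π s < m := by
  classical
  let e := S.orderEmbOfFin rfl
  let p : Finset (ℕ × ℕ) := Finset.univ.image fun j : Fin S.card => (e j, (j : ℕ))
  have hp : p.card ≤ S.card := Finset.card_image_le.trans (by simp)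
  obtain ⟨π, hπ, hπp⟩ := PartialAut.exists_perm hκ ⟨p, by
      simp only [p, Finset.forall_mem_image]
      intro i _ j _
      rw [e.injective.eq_iff, Fin.ext_iff], fun T hT => by
      have hT' := Finset.card_le_card hT
      rw [hκ.eq_one, hκ.eq_one]
      · have := Finset.card_image_le (s := T) (f := Prod.snd); omega
      · have := Finset.card_image_le (s := T) (f := Prod.fst); omega⟩
  refine ⟨π, hπ, fun s hs => ?_⟩
  obtain ⟨j, rfl⟩ : s ∈ Set.range e := by simpa [e] using hs
  have := hπp (e j, j) (Finset.mem_image_of_mem _ (Finset.mem_univ j))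
  simp only at this
  omega

theorem exists_color_eq (hκ : IsGenericColoring m κ) (hm : 0 < m) (n : ℕ) :
    ∃ S : Finset ℕ, S.card = m ∧ κ S = n := by
  obtain ⟨x, hx, h⟩ := hκ.exists_insert (Finset.range (m - 1)) fun _ => n
  refine ⟨insert x (Finset.range (m - 1)), ?_, h _ subset_rfl ?_⟩
  · rw [Finset.card_insert_of_notMem hx, Finset.card_range]; omega
  · rw [Finset.card_range]; omega

end IsGenericColoring

/-! ### The forms attached to a coloring -/

variable {V : Type*} [AddCommGroup V] [Module ℂ V] (B : Module.Basis ℕ ℂ V)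
  {m : ℕ} {κ : Finset ℕ → ℕ}

/-- The basis of the tensor power `⨂[ℂ]^k V` consisting of the tensor monomials
`B (a 0) ⊗ ⋯ ⊗ B (a (k - 1))`. -/
noncomputable def tensorBasis (k : ℕ) : Module.Basis (Fin k → ℕ) ℂ (⨂[ℂ]^k V) :=
  Basis.piTensorProduct fun _ => B

theorem tensorBasis_apply {k : ℕ} (a : Fin k → ℕ) :
    tensorBasis B k a = PiTensorProduct.tprod ℂ fun j => B (a j) := by
  simp [tensorBasis]

theorem tensorBasis_repr_tprod {k : ℕ} (v : Fin k → V) (a : Fin k → ℕ) :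
    (tensorBasis B k).repr (PiTensorProduct.tprod ℂ v) a = ∏ j, B.repr (v j) (a j) := by
  simp only [tensorBasis]
  exact (Basis.piTensorProduct_repr_tprod_apply _ _ _).trans (by simp)

/-- The monomial with indices `a` is balanced if all of its exponents are divisible by `m`. -/
def IsBalanced (m : ℕ) {d : ℕ} (a : Fin d → ℕ) : Prop :=
  ∀ i, m ∣ (Finset.univ.filter fun j => a j = i).card

open scoped Classical in
/-- The value of `balancedForm` at the basis vectors with indices `a`. -/
noncomputable def balancedCoeff (m : ℕ) (κ : Finset ℕ → ℕ) {d : ℕ} (a : Fin d → ℕ) : ℂ :=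
  if IsBalanced m a then (κ (Finset.univ.image a) : ℂ) else 0

/-- The multilinear form of degree `d` on `V` whose monomials are the balanced ones, each
weighted by the color of the set of variables occurring in it. -/
noncomputable def balancedForm (m : ℕ) (κ : Finset ℕ → ℕ) (d : ℕ) :
    MultilinearMap ℂ (fun _ : Fin d => V) ℂ :=
  ((tensorBasis B d).constr ℂ (balancedCoeff m κ)).compMultilinearMap (PiTensorProduct.tprod ℂ)

theorem balancedForm_basis {d : ℕ} (a : Fin d → ℕ) :
    balancedForm B m κ d (fun j => B (a j)) = balancedCoeff m κ a := by
  rw [balancedForm, LinearMap.compMultilinearMap_apply, ← tensorBasis_apply,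
    Module.Basis.constr_basis]

theorem balancedForm_ext {d : ℕ} {f g : MultilinearMap ℂ (fun _ : Fin d => V) ℂ}
    (h : ∀ a : Fin d → ℕ, f (fun j => B (a j)) =
      g (fun j => B (a j))) : f = g :=
  Module.Basis.ext_multilinear (fun _ => B) fun a => by simpa using h a

theorem isBalanced_comp_perm_left {d : ℕ} (π : Equiv.Perm ℕ) (a : Fin d → ℕ) :
    IsBalanced m (π ∘ a) ↔ IsBalanced m a := by
  refine ⟨fun h i => ?_, fun h i => ?_⟩
  · simpa using h (π i)
  · simpa [← Equiv.eq_symm_apply] using h (π.symm i)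

theorem isBalanced_comp_perm_right {d : ℕ} (a : Fin d → ℕ) (σ : Equiv.Perm (Fin d)) :
    IsBalanced m (a ∘ σ) ↔ IsBalanced m a := by
  refine forall_congr' fun i => ?_
  rw [← Finset.card_map σ.toEmbedding]
  congr! 2
  ext j
  simp [Finset.mem_map_equiv]

theorem IsBalanced.prod_eq_one {d : ℕ} {a : Fin d → ℕ} (ha : IsBalanced m a) {z : ℕ → ℂ}
    (hz : ∀ i, z i ^ m = 1) : ∏ j, z (a j) = 1 := by
  rw [Finset.prod_comp z a]
  refine Finset.prod_eq_one fun i _ => ?_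
  obtain ⟨c, hc⟩ := ha i
  rw [hc, pow_mul, hz, one_pow]

theorem balancedForm_perm {d : ℕ} (σ : Equiv.Perm (Fin d)) (v : Fin d → V) :
    balancedForm B m κ d (fun j => v (σ j)) = balancedForm B m κ d v := by
  have : (balancedForm B m κ d).domDomCongr σ = balancedForm B m κ d :=
    balancedForm_ext B fun a => by
      rw [MultilinearMap.domDomCongr_apply, balancedForm_basis, balancedForm_basis]
      have himage : Finset.univ.image (fun j => a (σ j)) = Finset.univ.image a := by
        rw [← Function.comp_def, ← Finset.image_image, Finset.image_univ_equiv]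
      have hb : IsBalanced m (fun j => a (σ j)) ↔ IsBalanced m a :=
        isBalanced_comp_perm_right a σ
      classical rw [balancedCoeff, balancedCoeff, himage, if_congr hb rfl rfl]
  exact congr($this v)

/-- Balanced forms are invariant under permuting the variables by an automorphism of the coloring
and scaling them by `m`-th roots of unity: the scalars cancel in every balanced monomial. -/
theorem balancedForm_comp_of_monomial {d : ℕ} {g : V ≃ₗ[ℂ] V} {z : ℕ → ℂ}
    {π : Equiv.Perm ℕ} (hg : ∀ i, g (B i) = z i • B (π i))
    (hz : ∀ i, z i ^ m = 1) (hπ : ∀ S, κ (S.image π) = κ S) (v : Fin d → V) :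
    balancedForm B m κ d (fun j => g (v j)) = balancedForm B m κ d v := by
  have : (balancedForm B m κ d).compLinearMap (fun _ => g.toLinearMap) = balancedForm B m κ d :=
    balancedForm_ext B fun a => by
      rw [MultilinearMap.compLinearMap_apply, balancedForm_basis B]
      simp only [LinearEquiv.coe_coe, hg]
      rw [MultilinearMap.map_smul_univ, balancedForm_basis B fun j => π (a j)]
      have himage : Finset.univ.image (fun j => π (a j)) = (Finset.univ.image a).image π := by
        rw [Finset.image_image]; rfl
      have hb : IsBalanced m (fun j => π (a j)) ↔ IsBalanced m a :=
        isBalanced_comp_perm_left π a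
      classical rw [balancedCoeff, balancedCoeff, himage, hπ, if_congr hb rfl rfl]
      split_ifs with h
      · rw [h.prod_eq_one hz, one_smul]
      · rw [smul_zero]
  exact congr($this v)

/-! ### The Fermat form and monomial matrices -/

/-- In degree `m`, with color `1` on singletons, the balanced form is the Fermat form
`∑ i, ∏ j, B.repr (v j) i`; evaluating it with a basis vector in one slot picks out a single
summand. -/
theorem balancedForm_eq_prod (hκ1 : ∀ i, κ {i} = 1) (v : Fin m → V)
    (j₀ : Fin m) (i : ℕ) (hv : v j₀ = B i) :
    balancedForm B m κ m v = ∏ j, B.repr (v j) i := by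
  have hconst : balancedCoeff m κ (fun _ : Fin m => i) = 1 := by
    have hb : IsBalanced m (fun _ : Fin m => i) := fun l => by
      by_cases h : i = l <;> simp [h]
    have : Finset.univ.image (fun _ : Fin m => i) = {i} :=
      Finset.image_const ⟨j₀, Finset.mem_univ _⟩ i
    rw [balancedCoeff, if_pos hb, this, hκ1, Nat.cast_one]
  rw [balancedForm, LinearMap.compMultilinearMap_apply, Module.Basis.constr_apply,
    Finsupp.sum, Finset.sum_eq_single fun _ => i]
  · rw [tensorBasis_repr_tprod, hconst, smul_eq_mul, mul_one]
  · intro a ha hai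
    rw [tensorBasis_repr_tprod]
    by_cases h0 : a j₀ = i
    · -- A balanced monomial of degree `m` is the `m`-th power of a single variable.
      have : ¬ IsBalanced m a := fun hb => hai <| by
        have hpos : 0 < (Finset.univ.filter fun j => a j = i).card :=
          Finset.card_pos.2 ⟨j₀, by simpa using h0⟩
        have hle := Nat.le_of_dvd hpos (hb i)
        have : (Finset.univ.filter fun j => a j = i) = Finset.univ :=
          Finset.eq_univ_of_card _ (le_antisymm (Finset.card_le_univ _) (by simpa using hle))
        funext j
        have hj := this ▸ Finset.mem_univ j
        exact (Finset.mem_filter.1 hj).2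
      rw [balancedCoeff, if_neg this, smul_zero]
    · rw [Finset.prod_eq_zero (Finset.mem_univ j₀), zero_smul]
      rw [hv, B.repr_self, Finsupp.single_eq_of_ne h0]
  · intro h
    rw [Finsupp.notMem_support_iff] at h
    rw [h, zero_smul]

/-- The linear symmetries of the Fermat form of degree at least `3` are monomial. -/
theorem exists_monomial_of_balancedForm_comp (hm : 3 ≤ m) (hκ1 : ∀ i, κ {i} = 1)
    {g : V ≃ₗ[ℂ] V}
    (hg : ∀ v, balancedForm B m κ m (fun j => g (v j)) = balancedForm B m κ m v) :
    ∃ (z : ℕ → ℂ) (π : ℕ → ℕ), (∀ i, g (B i) = z i • B (π i)) ∧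
      (∀ i, z i ^ m = 1) ∧ Function.Injective π := by
  classical
  set G : ℕ → ℕ →₀ ℂ := fun a => B.repr (g (B a)) with hG
  let j₀ : Fin m := ⟨0, by omega⟩
  let j₁ : Fin m := ⟨1, by omega⟩
  let j₂ : Fin m := ⟨2, by omega⟩
  have h01 : j₁ ≠ j₀ := by simp [j₀, j₁]
  have h02 : j₂ ≠ j₀ := by simp [j₀, j₂]
  have h12 : j₂ ≠ j₁ := by simp [j₁, j₂]
  -- Each row of the matrix of `g` has at most one nonzero entry: evaluate the form at
  -- `g (B a), g (B b), B i, …, B i`, where the slot `j₂` exists because `m ≥ 3`.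
  have hrow : ∀ i a b, a ≠ b → G a i = 0 ∨ G b i = 0 := by
    intro i a b hab
    let w : Fin m → V := fun j => if j = j₀ then B a else
      if j = j₁ then B b else g.symm (B i)
    have hz : balancedForm B m κ m w = 0 := by
      rw [balancedForm_eq_prod B hκ1 w j₀ a (by simp [w])]
      exact Finset.prod_eq_zero (Finset.mem_univ j₁) (by simp [w, h01, hab])
    rw [← hg, balancedForm_eq_prod B hκ1 _ j₂ i (by simp [w, h02, h12]),
      Finset.prod_eq_zero_iff] at hz
    obtain ⟨j, -, hj⟩ := hz
    simp only [w] at hj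
    split_ifs at hj
    · exact Or.inl hj
    · exact Or.inr hj
    · simp at hj
  have hcoord : ∀ i a, G a i ≠ 0 → ∀ v, B.repr (g v) i = B.repr v a * G a i := by
    intro i a ha v
    have : B.coord i ∘ₗ g.toLinearMap = G a i • B.coord a := by
      refine B.ext fun b => ?_
      by_cases hab : b = a
      · subst hab; simp [hG]
      · simpa [hab] using (hrow i a b (Ne.symm hab)).resolve_left ha
    have := congr($this v)
    simpa [mul_comm] using this
  have hcol : ∀ a i j, G a i ≠ 0 → G a j ≠ 0 → i = j := by
    intro a i j hi hj
    by_contra hij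
    have h1 := hcoord i a hi (g.symm (B i))
    have h2 := hcoord j a hj (g.symm (B i))
    rw [g.apply_symm_apply, B.repr_self, Finsupp.single_eq_same] at h1
    rw [g.apply_symm_apply, B.repr_self, Finsupp.single_eq_of_ne (Ne.symm hij)] at h2
    rcases mul_eq_zero.1 h2.symm with h | h
    · rw [h, zero_mul] at h1; exact one_ne_zero h1
    · exact hj h
  have hne : ∀ a, ∃ i, G a i ≠ 0 := fun a => by
    by_contra! h
    have : G a = 0 := Finsupp.ext h
    exact B.ne_zero a (by simpa [hG] using this)
  choose π hπ using hne
  have hmon : ∀ a, g (B a) = G a (π a) • B (π a) := fun a => by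
    refine B.repr.injective (Finsupp.ext fun i => ?_)
    change G a i = _
    by_cases h : i = π a
    · subst h; simp
    · have : G a i = 0 := by
        by_contra h'
        exact h (hcol a _ _ h' (hπ a))
      simp [this, h]
  refine ⟨fun a => G a (π a), π, hmon, fun a => ?_, fun a b hab => ?_⟩
  · have h1 : balancedForm B m κ m (fun _ => B a) = 1 := by
      rw [balancedForm_eq_prod B hκ1 _ j₀ a rfl]; simp
    have h2 : balancedForm B m κ m (fun _ => B (π a)) = 1 := by
      rw [balancedForm_eq_prod B hκ1 _ j₀ (π a) rfl]; simp
    rw [← hg] at h1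
    simp only [hmon a] at h1
    rw [MultilinearMap.map_smul_univ (balancedForm B m κ m) (fun _ => G a (π a))
      (fun _ => B (π a)), h2] at h1
    simpa using h1
  · by_contra h
    rcases hrow (π a) a b h with h | h
    · exact hπ a h
    · exact hπ b (hab ▸ h)

theorem Finset.exists_fin_image_univ_eq {S : Finset ℕ} {n : ℕ} (hS : S.Nonempty) (hn : S.card ≤ n) :
    ∃ a : Fin n → ℕ, Finset.univ.image a = S := by
  obtain ⟨s, hs⟩ := hS
  refine ⟨fun j => if h : (j : ℕ) < S.card then S.orderEmbOfFin rfl ⟨j, h⟩ else s, ?_⟩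
  ext x
  simp only [Finset.mem_image, Finset.mem_univ, true_and]
  constructor
  · rintro ⟨j, rfl⟩
    split_ifs
    · exact Finset.orderEmbOfFin_mem _ _ _
    · exact hs
  · intro hx
    obtain ⟨j, rfl⟩ : x ∈ Set.range (S.orderEmbOfFin rfl) := by simpa using hx
    exact ⟨⟨j, j.2.trans_le hn⟩, by simp⟩

/-- Every `m`-element set occurs as the variables of a balanced monomial of degree `m ^ 2 + m`:
one variable has exponent `2 * m` and the others have exponent `m`. -/
theorem exists_isBalanced_image_eq {S : Finset ℕ} (hS : S.card = m) (hm : 0 < m) :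
    ∃ a : Fin (m ^ 2 + m) → ℕ, IsBalanced m a ∧ Finset.univ.image a = S := by
  obtain ⟨h, hh⟩ := Finset.exists_fin_image_univ_eq (n := m + 1)
    (Finset.card_pos.1 (hS ▸ hm)) (by omega)
  let e : Fin (m ^ 2 + m) ≃ Fin (m + 1) × Fin m :=
    (finCongr (by ring)).trans finProdFinEquiv.symm
  refine ⟨fun j => h (e j).1, fun i => ?_, ?_⟩
  · have : (Finset.univ.filter fun j => h (e j).1 = i).card =
        ((Finset.univ.filter fun q => h q = i) ×ˢ (Finset.univ : Finset (Fin m))).card := by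
      rw [← Finset.card_map e.toEmbedding]
      congr 1
      ext p
      simp [Finset.mem_map_equiv]
    rw [this, Finset.card_product, Finset.card_univ, Fintype.card_fin]
    exact dvd_mul_left _ _
  · rw [← hh]
    ext x
    simp only [Finset.mem_image, Finset.mem_univ, true_and]
    constructor
    · rintro ⟨j, rfl⟩; exact ⟨_, rfl⟩
    · rintro ⟨q, rfl⟩; exact ⟨e.symm (q, ⟨0, hm⟩), by simp⟩

theorem color_image_eq_of_balancedForm_comp (hm : 0 < m) {g : V ≃ₗ[ℂ] V}
    {z : ℕ → ℂ} {π : ℕ → ℕ} (hg : ∀ i, g (B i) = z i • B (π i))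
    (hz : ∀ i, z i ^ m = 1) (hπ : Function.Injective π)
    (hinv : ∀ v, balancedForm B m κ (m ^ 2 + m) (fun j => g (v j)) =
      balancedForm B m κ (m ^ 2 + m) v) {S : Finset ℕ} (hS : S.card = m) :
    κ (S.image π) = κ S := by
  obtain ⟨a, ha, rfl⟩ := exists_isBalanced_image_eq hS hm
  have h := hinv fun j => B (a j)
  simp only [hg] at h
  rw [MultilinearMap.map_smul_univ, balancedForm_basis B a,
    balancedForm_basis B fun j => π (a j), ha.prod_eq_one hz, one_smul] at h
  have hb : IsBalanced m fun j => π (a j) := fun i => by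
    by_cases hi : ∃ l, π l = i
    · obtain ⟨l, rfl⟩ := hi
      simpa [hπ.eq_iff] using ha l
    · push Not at hi
      simp [hi]
  rw [balancedCoeff, balancedCoeff, if_pos ha, if_pos hb, Nat.cast_inj] at h
  rw [Finset.image_image]
  exact h

/-! ### The automorphism group -/

/-- The `d`-space with the balanced forms of all prescribed degrees. -/
noncomputable def balancedForms (m : ℕ) (κ : Finset ℕ → ℕ) {r : ℕ} (d : Fin r → ℕ) :
    TensorForms d V where
  form i := balancedForm B m κ (d i)

/-- Monomial matrices with `m`-th roots of unity as entries and an automorphism of the coloring as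
underlying permutation are automorphisms of the balanced forms. -/
theorem exists_aut_monomial {r : ℕ} (d : Fin r → ℕ) (z : ℕ → ℂ) (hm : m ≠ 0)
    (hz : ∀ i, z i ^ m = 1) (π : Equiv.Perm ℕ) (hπ : ∀ S, κ (S.image π) = κ S) :
    ∃ g : (balancedForms B m κ d).aut, ∀ i,
      (g : V ≃ₗ[ℂ] V) (B i) = z i • B (π i) := by
  have hz0 : ∀ i, z i ≠ 0 := fun i h => by simpa [h, hm] using hz i
  let e : V ≃ₗ[ℂ] V := B.equiv
    (B.unitsSMul fun i => Units.mk0 _ (hz0 (π.symm i))) π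
  have he : ∀ i, e (B i) = z i • B (π i) := fun i => by
    have := B.equiv_apply (R := ℂ) i
      (B.unitsSMul fun i => Units.mk0 _ (hz0 (π.symm i))) π
    refine this.trans ?_
    simp [Module.Basis.unitsSMul_apply, Units.smul_def]
  exact ⟨⟨e, fun i v => balancedForm_comp_of_monomial B he hz hπ v⟩, he⟩

theorem tensorPowerRep_tensorBasis {r : ℕ} {d : Fin r → ℕ} {T : TensorForms d V}
    {g : T.aut} {z : ℕ → ℂ} {π : ℕ → ℕ}
    (hg : ∀ i, (g : V ≃ₗ[ℂ] V) (B i) =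
      z i • B (π i)) {k : ℕ} (a : Fin k → ℕ) :
    T.tensorPowerRep k g (tensorBasis B k a) =
      (∏ j, z (a j)) • tensorBasis B k (fun j => π (a j)) := by
  rw [tensorBasis_apply, tensorBasis_apply]
  refine (PiTensorProduct.map_tprod _ _).trans ?_
  simp only [LinearEquiv.coe_coe, hg]
  rw [MultilinearMap.map_smul_univ]

/-! ### Tensor powers below `m` have finite length -/

/-- The elements scaling one basis vector by a primitive `m`-th root of unity `ζ` read off how
often that vector occurs in a tensor monomial. -/
theorem exists_aut_repr_eq {r : ℕ} (d : Fin r → ℕ) (hm : m ≠ 0) {ζ : ℂ}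
    (hζ : ζ ^ m = 1) (i k : ℕ) : ∃ g : (balancedForms B m κ d).aut, ∀ x a,
      (tensorBasis B k).repr ((balancedForms B m κ d).tensorPowerRep k g x) a =
        ζ ^ (Finset.univ.filter fun j => a j = i).card * (tensorBasis B k).repr x a := by
  obtain ⟨g, hg⟩ := exists_aut_monomial B (κ := κ) d (fun l => if l = i then ζ else 1) hm
    (fun l => by split_ifs <;> simp [hζ]) 1 (fun S => by simp)
  refine ⟨g, fun x a => ?_⟩
  have : (Finsupp.lapply a).comp ((tensorBasis B k).repr.toLinearMap.comp
      ((balancedForms B m κ d).tensorPowerRep k g)) =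
      ζ ^ (Finset.univ.filter fun j => a j = i).card •
        (Finsupp.lapply a).comp (tensorBasis B k).repr.toLinearMap := by
    refine (tensorBasis B k).ext fun b => ?_
    have h := tensorPowerRep_tensorBasis B hg b
    simp only [LinearMap.comp_apply, LinearMap.smul_apply, LinearEquiv.coe_coe, h,
      Equiv.Perm.coe_one, id, map_smul, Module.Basis.repr_self, Finsupp.lapply_apply]
    by_cases hab : b = a
    · subst hab
      simp [Finset.prod_ite]
    · rw [Finsupp.single_eq_of_ne (Ne.symm hab), smul_zero, smul_zero]
  exact congr($this x)

/-- The span of the tensor monomials in the first `m` basis vectors. -/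
noncomputable def initialTensors (m k : ℕ) : Submodule ℂ (⨂[ℂ]^k V) :=
  Submodule.span ℂ (tensorBasis B k '' {a | ∀ j, a j < m})

instance finiteDimensional_initialTensors (m k : ℕ) : FiniteDimensional ℂ (initialTensors B m k) := by
  refine FiniteDimensional.span_of_finite ℂ (Set.Finite.image _ ?_)
  refine (Set.Finite.pi' fun _ : Fin k => Set.finite_Iio m).subset fun a ha => ha

/-- For `k < m` a subrepresentation is determined by its intersection with the
finite-dimensional space `initialTensors B m k`, by torus weights and homogeneity. -/
theorem le_of_inf_initialTensors_le {r : ℕ} {d : Fin r → ℕ} (hκ : IsGenericColoring m κ)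
    {k : ℕ} (hk : k < m)
    (N N' : Subrepresentation ((balancedForms B m κ d).tensorPowerRep k))
    (h : ∀ x ∈ N.toSubmodule, x ∈ initialTensors B m k → x ∈ N'.toSubmodule)
    {x : ⨂[ℂ]^k V} (hx : x ∈ N.toSubmodule) : x ∈ N'.toSubmodule := by
  have hm : m ≠ 0 := by omega
  induction hn : ((tensorBasis B k).repr x).support.card using Nat.strong_induction_on
    generalizing x with | _ n ih => ?_
  subst hn
  by_cases hw : ∃ a ∈ ((tensorBasis B k).repr x).support, ∃ b ∈ ((tensorBasis B k).repr x).support,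
      ∃ i, (Finset.univ.filter fun j => a j = i).card ≠ (Finset.univ.filter fun j => b j = i).card
  · -- Two monomials of `x` have different weights: split `x` by the operator
    -- `(g - ζ ^ t) / (ζ ^ s - ζ ^ t)`, which fixes one of them and kills the other.
    obtain ⟨a, ha, b, hb, i, hab⟩ := hw
    set s := (Finset.univ.filter fun j => a j = i).card
    set t := (Finset.univ.filter fun j => b j = i).card
    have hs : s < m := ((Finset.card_le_univ _).trans (by simp)).trans_lt hk
    have ht : t < m := ((Finset.card_le_univ _).trans (by simp)).trans_lt hk
    obtain ⟨ζ, hζ⟩ : ∃ ζ : ℂ, IsPrimitiveRoot ζ m :=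
      ⟨_, Complex.isPrimitiveRoot_exp m hm⟩
    have hne : ζ ^ s - ζ ^ t ≠ 0 := sub_ne_zero.2 fun h => hab (hζ.pow_inj hs ht h)
    obtain ⟨g, hg⟩ := exists_aut_repr_eq B (κ := κ) d hm hζ.pow_eq_one i k
    set y := (ζ ^ s - ζ ^ t)⁻¹ • ((balancedForms B m κ d).tensorPowerRep k g x - ζ ^ t • x) with hy
    have hyN : y ∈ N.toSubmodule := N.toSubmodule.smul_mem _
      (N.toSubmodule.sub_mem (N.apply_mem_toSubmodule g hx) (N.toSubmodule.smul_mem _ hx))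
    have hyr : ∀ c, (tensorBasis B k).repr y c = (ζ ^ s - ζ ^ t)⁻¹ *
        (ζ ^ (Finset.univ.filter fun j => c j = i).card - ζ ^ t) * (tensorBasis B k).repr x c := by
      intro c
      rw [hy, map_smul, map_sub, map_smul, Finsupp.smul_apply, Finsupp.sub_apply,
        Finsupp.smul_apply, hg, smul_eq_mul, smul_eq_mul]
      ring
    have hya : (tensorBasis B k).repr y a = (tensorBasis B k).repr x a := by
      rw [hyr, inv_mul_cancel₀ hne, one_mul]
    have hyb : (tensorBasis B k).repr y b = 0 := by
      rw [hyr, sub_self, mul_zero, zero_mul]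
    have hys : y ∈ N'.toSubmodule := by
      refine ih _ (Finset.card_lt_card ?_) hyN rfl
      refine Finset.ssubset_iff_subset_ne.2 ⟨fun c hc => ?_, fun h => ?_⟩
      · rw [Finsupp.mem_support_iff, hyr] at hc
        exact Finsupp.mem_support_iff.2 (right_ne_zero_of_mul hc)
      · rw [← h] at hb
        exact Finsupp.mem_support_iff.1 hb hyb
    have hxys : x - y ∈ N'.toSubmodule := by
      refine ih _ (Finset.card_lt_card ?_) (N.toSubmodule.sub_mem hx hyN) rfl
      refine Finset.ssubset_iff_subset_ne.2 ⟨fun c hc => ?_, fun h => ?_⟩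
      · rw [Finsupp.mem_support_iff, map_sub, Finsupp.sub_apply, hyr] at hc
        exact Finsupp.mem_support_iff.2 fun h => hc (by rw [h, mul_zero, sub_zero])
      · rw [← h] at ha
        refine Finsupp.mem_support_iff.1 ha ?_
        rw [map_sub, Finsupp.sub_apply, hya, sub_self]
    simpa using N'.toSubmodule.add_mem hxys hys
  · -- All monomials of `x` involve the same basis vectors: move these among the first `m`.
    push Not at hw
    by_cases hx0 : x = 0
    · rw [hx0]; exact N'.toSubmodule.zero_mem
    obtain ⟨a, ha⟩ : ((tensorBasis B k).repr x).support.Nonempty := by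
      simpa [Finsupp.support_nonempty_iff] using hx0
    obtain ⟨π, hπ, hlt⟩ := hκ.exists_perm_image_lt (S := Finset.univ.image a)
      ((Finset.card_image_le.trans (by simp)).trans_lt hk)
    obtain ⟨g, hg⟩ := exists_aut_monomial B d (fun _ => 1) hm (fun _ => one_pow m) π hπ
    have hgx : (balancedForms B m κ d).tensorPowerRep k g x ∈ initialTensors B m k := by
      rw [← (tensorBasis B k).linearCombination_repr x, Finsupp.linearCombination_apply,
        Finsupp.sum, map_sum]
      refine Submodule.sum_mem _ fun b hb => ?_
      rw [map_smul, tensorPowerRep_tensorBasis B hg b]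
      refine Submodule.smul_mem _ _ (Submodule.smul_mem _ _ (Submodule.subset_span ⟨_, ?_, rfl⟩))
      intro j
      refine hlt _ (Finset.mem_image.2 ?_)
      have hpos : 0 < (Finset.univ.filter fun j' => a j' = b j).card := by
        rw [hw a ha b hb (b j)]
        exact Finset.card_pos.2 ⟨j, by simp⟩
      obtain ⟨j', hj'⟩ := Finset.card_pos.1 hpos
      exact ⟨j', Finset.mem_univ _, (Finset.mem_filter.1 hj').2⟩
    have := N'.apply_mem_toSubmodule g⁻¹ (h _ (N.apply_mem_toSubmodule g hx) hgx)
    rwa [Representation.inv_self_apply] at this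

theorem isFiniteLength_tensorPowerRep {r : ℕ} (d : Fin r → ℕ) (hκ : IsGenericColoring m κ)
    {k : ℕ} (hk : k < m) :
    IsFiniteLength ℂ[(balancedForms B m κ d).aut]
      ((balancedForms B m κ d).tensorPowerRep k).asModule := by
  let F : Submodule ℂ[(balancedForms B m κ d).aut]
      ((balancedForms B m κ d).tensorPowerRep k).asModule →
      Submodule ℂ (initialTensors B m k) := fun N =>
    (Subrepresentation.subrepresentationSubmoduleOrderIso.symm N).toSubmodule.comap
      (initialTensors B m k).subtype
  have hF : StrictMono F := by
    intro N N' hlt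
    refine lt_of_le_not_ge (fun x hx => hlt.le hx) fun hle => hlt.not_ge ?_
    exact fun x hx => le_of_inf_initialTensors_le B hκ hk
      (Subrepresentation.subrepresentationSubmoduleOrderIso.symm N')
      (Subrepresentation.subrepresentationSubmoduleOrderIso.symm N)
      (fun y hy hyE => hle (x := ⟨y, hyE⟩) hy) hx
  rw [isFiniteLength_iff_isNoetherian_isArtinian]
  exact ⟨isNoetherian_iff'.2 hF.wellFoundedGT, hF.wellFoundedLT⟩

/-! ### Tensor powers from `m` on have infinite length -/

/-- The span of the tensor monomials on exactly `m` basis vectors whose color is at most `n`. -/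
noncomputable def colorFiltration (m : ℕ) (κ : Finset ℕ → ℕ) (k n : ℕ) :
    Submodule ℂ (⨂[ℂ]^k V) :=
  Submodule.span ℂ (tensorBasis B k ''
    {a | (Finset.univ.image a).card = m ∧ κ (Finset.univ.image a) ≤ n})

theorem tensorPowerRep_mem_colorFiltration (hm : 3 ≤ m) (hκ1 : ∀ i, κ {i} = 1) {k n : ℕ}
    (g : (balancedForms B m κ ![m ^ 2 + m, m, m]).aut) ⦃x : ⨂[ℂ]^k V⦄
    (hx : x ∈ colorFiltration B m κ k n) :
    (balancedForms B m κ ![m ^ 2 + m, m, m]).tensorPowerRep k g x ∈ colorFiltration B m κ k n := by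
  obtain ⟨z, π, hg, hz, hπ⟩ := exists_monomial_of_balancedForm_comp B hm hκ1 (g.2 1)
  suffices colorFiltration B m κ k n ≤ (colorFiltration B m κ k n).comap
      ((balancedForms B m κ ![m ^ 2 + m, m, m]).tensorPowerRep k g) from this hx
  refine Submodule.span_le.2 ?_
  rintro _ ⟨a, ⟨ha, hc⟩, rfl⟩
  rw [SetLike.mem_coe, Submodule.mem_comap, tensorPowerRep_tensorBasis B hg]
  have himage : Finset.univ.image (fun j => π (a j)) = (Finset.univ.image a).image π := by
    rw [Finset.image_image]; rfl
  refine Submodule.smul_mem _ _ (Submodule.subset_span ⟨_, ⟨?_, ?_⟩, rfl⟩)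
  · rw [himage, Finset.card_image_of_injective _ hπ, ha]
  · rwa [himage, color_image_eq_of_balancedForm_comp B (by omega) hg hz hπ (g.2 0) ha]

theorem colorFiltration_strictMono (hκ : IsGenericColoring m κ) (hm : 0 < m) {k : ℕ}
    (hk : m ≤ k) : StrictMono (colorFiltration B m κ k) := by
  refine strictMono_nat_of_lt_succ fun n => lt_of_le_not_ge ?_ fun hle => ?_
  · exact Submodule.span_mono (Set.image_mono fun a ha => ⟨ha.1, ha.2.trans n.le_succ⟩)
  · obtain ⟨S, hS, hSn⟩ := hκ.exists_color_eq hm (n + 1)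
    obtain ⟨a, rfl⟩ := Finset.exists_fin_image_univ_eq (n := k)
      (Finset.card_pos.1 (hS ▸ hm)) (hS.trans_le hk)
    have hmem : tensorBasis B k a ∈ colorFiltration B m κ k n :=
      hle (Submodule.subset_span ⟨a, ⟨hS, hSn.le⟩, rfl⟩)
    have := (tensorBasis B k).mem_span_image.1 hmem
    rw [Module.Basis.repr_self] at this
    have h2 := (this (Finset.mem_coe.2 (by simp : a ∈ (Finsupp.single a (1 : ℂ)).support))).2
    omega

theorem not_isFiniteLength_tensorPowerRep (hκ : IsGenericColoring m κ) (hm : 3 ≤ m) {k : ℕ}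
    (hk : m ≤ k) :
    ¬ IsFiniteLength ℂ[(balancedForms B m κ ![m ^ 2 + m, m, m]).aut]
      ((balancedForms B m κ ![m ^ 2 + m, m, m]).tensorPowerRep k).asModule := by
  rw [isFiniteLength_iff_isNoetherian_isArtinian]
  rintro ⟨hN, -⟩
  have hκ1 : ∀ i, κ {i} = 1 := fun i => hκ.eq_one _ (by rw [Finset.card_singleton]; omega)
  let W : ℕ → Submodule ℂ[(balancedForms B m κ ![m ^ 2 + m, m, m]).aut]
      ((balancedForms B m κ ![m ^ 2 + m, m, m]).tensorPowerRep k).asModule := fun n =>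
    Subrepresentation.subrepresentationSubmoduleOrderIso
      ⟨colorFiltration B m κ k n, fun g => tensorPowerRep_mem_colorFiltration B hm hκ1 g⟩
  have hW : StrictMono W := fun i j hij =>
    Subrepresentation.subrepresentationSubmoduleOrderIso.strictMono
      (colorFiltration_strictMono B hκ (by omega) hk hij)
  have := isNoetherian_iff'.1 hN
  exact not_strictMono_of_wellFoundedGT W hW

theorem theorem1p3 (m : ℕ) (hm : 3 ≤ m) :
    ∃ (V : Type) (_ : AddCommGroup V) (_ : Module ℂ V)
      (T : TensorForms ![m ^ 2 + m, m, m] V),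
      T.IsSymmetric ∧ Module.rank ℂ V = ℵ₀ ∧
        ∀ k : ℕ, IsFiniteLength ℂ[T.aut] (T.tensorPowerRep k).asModule ↔ k < m := by
  obtain ⟨κ, hκ⟩ := exists_isGenericColoring m
  let B : Module.Basis ℕ ℂ (ℕ →₀ ℂ) := Finsupp.basisSingleOne
  refine ⟨ℕ →₀ ℂ, inferInstance, inferInstance, balancedForms B m κ _,
    fun i σ v => balancedForm_perm B σ v, by simp, fun k => ⟨fun h => ?_,
      isFiniteLength_tensorPowerRep B _ hκ⟩⟩
  by_contra hk
  exact not_isFiniteLength_tensorPowerRep B hκ hm (not_lt.1 hk) h
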